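/- Let $\Gamma$ denote the Gamma function and $(a)_n = a(a+1)\cdots(a+n-1)$, $(a)_0=1$, the Pochhammer symbol (rising factorial). The following two series converge and have the stated sums: $$\frac{36\sqrt{3}\,\Gamma(1/4)^{2}}{\pi^{3/2}}=\sum_{n=0}^{\infty}\frac{(640n^{2}+608n+147)\,(8n)!}{[(2n+1)!]^{2}\,(4n)!\,24^{4n}},$$ $$\frac{128\,\pi^{1/2}}{2^{1/4}\,\Gamma(3/4)^{2}}=\sum_{n=0}^{\infty}(448n^{2}+496n+127)\left(\frac{(1/8)_n\,(5/8)_n}{2^{n}\,(2n+1)!}\right)^{2}.$$ -/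

import Mathlib

open scoped Nat

section

open MeasureTheory Set

/-! Each series is a Gauss series ₂F₁(a, b; 1; x) with its terms grouped in pairs; the quadratic
polynomial comes from adding the terms of index 2n and 2n + 1. The first uses (a, b; x) = (1/4, 3/4;
1/9), the second (1/4, 1/4; -1/8), and Pfaff's transformation carries the second to the first, as
x/(x - 1) = 1/9 at x = -1/8. It remains to evaluate one series. By `hasSum_gaussTerm_sq` it is the
mean over (0, π) of (1 - (cos t)/3)^(-1/2), which `integral_one_sub_cos_div_three` turns into the
Beta integral B(1/4, 1/2). -/

theorem HasSum.of_eq {f g : ℕ → ℝ} {S T : ℝ} (h : HasSum f S) (hfg : ∀ n, g n = f n)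
    (hST : T = S) : HasSum g T := by
  rwa [hST, funext hfg]

/-! ### Binomial series and Beta integrals -/

theorem Real.hasSum_one_sub_rpow_neg (a : ℝ) {x : ℝ} (hx : |x| < 1) :
    HasSum (fun n : ℕ => (ascPochhammer ℝ n).eval a / (n ! : ℝ) * x ^ n) ((1 - x) ^ (-a)) := by
  have h := (Real.one_div_one_sub_rpow_hasFPowerSeriesOnBall_zero a).hasSum (y := x)
    (by simpa [enorm_eq_nnnorm] using! hx)
  have h1 : 0 ≤ 1 - x := by linarith [le_abs_self x]
  rw [Real.rpow_neg h1, ← one_div]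
  rw [zero_add] at h
  refine h.of_eq (fun n => ?_) rfl
  have hn : (n ! : ℝ) ≠ 0 := by positivity
  have hm := Ring.factorial_nsmul_multichoose_eq_ascPochhammer a n
  rw [Ring.multichoose_eq, Polynomial.ascPochhammer_smeval_eq_eval, nsmul_eq_mul] at hm
  rw [← hm, mul_div_cancel_left₀ _ hn]
  simp [mul_comm]

/-- Integrating the binomial series of `(1 - x g)⁻ᵃ` term by term against an integrable weight. -/
theorem hasSum_integral_one_sub_mul_rpow_neg {α : Type*} [MeasurableSpace α] {μ : Measure α}
    {g w : α → ℝ} (hg : AEStronglyMeasurable g μ) (hg1 : ∀ᵐ t ∂μ, |g t| ≤ 1)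
    (hw : Integrable w μ) (a : ℝ) {x : ℝ} (hx : |x| < 1) :
    HasSum (fun n : ℕ => (ascPochhammer ℝ n).eval a / (n ! : ℝ) * x ^ n * ∫ t, g t ^ n * w t ∂μ)
      (∫ t, (1 - x * g t) ^ (-a) * w t ∂μ) := by
  set c : ℕ → ℝ := fun n => (ascPochhammer ℝ n).eval a / (n ! : ℝ) * x ^ n
  have hs : Summable fun n => |c n| := (Real.hasSum_one_sub_rpow_neg a hx).summable.abs
  simp_rw [← integral_const_mul]
  refine hasSum_integral_of_dominated_convergence (fun n t => |c n| * |w t|) ?_ ?_ ?_ ?_ ?_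
  · intro n
    exact ((hg.pow n).mul hw.1).const_mul _
  · intro n
    filter_upwards [hg1] with t ht
    rw [Real.norm_eq_abs, abs_mul, abs_mul, abs_pow]
    refine mul_le_mul_of_nonneg_left ?_ (by positivity)
    rw [abs_mul, abs_pow]
    exact mul_le_of_le_one_left (abs_nonneg _) (pow_le_one₀ (abs_nonneg _) ht)
  · exact .of_forall fun t => hs.mul_right _
  · simp_rw [tsum_mul_right]
    exact hw.abs.const_mul _
  · filter_upwards [hg1] with t ht
    have hxt : |x * g t| < 1 := by
      rw [abs_mul]
      exact (mul_le_of_le_one_right (abs_nonneg _) ht).trans_lt hx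
    refine ((Real.hasSum_one_sub_rpow_neg a hxt).mul_right (w t)).of_eq (fun n => ?_) rfl
    rw [mul_pow]
    ring

theorem Real.integrableOn_rpow_mul_one_sub_rpow {u v : ℝ} (hu : 0 < u) (hv : 0 < v) :
    IntegrableOn (fun t : ℝ => t ^ (u - 1) * (1 - t) ^ (v - 1)) (Ioo 0 1) ∧
    ∫ t in Ioo (0 : ℝ) 1, t ^ (u - 1) * (1 - t) ^ (v - 1) =
      Real.Gamma u * Real.Gamma v / Real.Gamma (u + v) := by
  have hC : EqOn (fun t : ℝ => ((t ^ (u - 1) * (1 - t) ^ (v - 1) : ℝ) : ℂ))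
      (fun t : ℝ => (t : ℂ) ^ ((u : ℂ) - 1) * (1 - (t : ℂ)) ^ ((v : ℂ) - 1)) (Ioo 0 1) := by
    intro t ht
    simp only
    rw [Complex.ofReal_mul, Complex.ofReal_cpow ht.1.le, Complex.ofReal_cpow (by linarith [ht.2])]
    push_cast
    rfl
  have hI := Complex.betaIntegral_convergent (u := u) (v := v) (by simpa) (by simpa)
  rw [intervalIntegrable_iff_integrableOn_Ioo_of_le zero_le_one] at hI
  have hI' : IntegrableOn (fun t : ℝ => ((t ^ (u - 1) * (1 - t) ^ (v - 1) : ℝ) : ℂ)) (Ioo 0 1) :=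
    (integrableOn_congr_fun hC measurableSet_Ioo).2 hI
  refine ⟨by simpa [IntegrableOn] using hI'.re, ?_⟩
  have hB := Complex.betaIntegral_eq_Gamma_mul_div u v (by simpa) (by simpa)
  rw [Complex.betaIntegral, intervalIntegral.integral_of_le zero_le_one,
    integral_Ioc_eq_integral_Ioo, ← setIntegral_congr_fun measurableSet_Ioo hC,
    integral_complex_ofReal] at hB
  rw [← Complex.ofReal_add, Complex.Gamma_ofReal, Complex.Gamma_ofReal, Complex.Gamma_ofReal] at hB
  exact_mod_cast hB

theorem Real.Gamma_add_natCast {b : ℝ} (hb : 0 < b) (n : ℕ) :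
    Real.Gamma (b + n) = (ascPochhammer ℝ n).eval b * Real.Gamma b := by
  induction n with
  | zero => simp
  | succ n ih =>
    rw [ascPochhammer_succ_eval, Nat.cast_succ, ← add_assoc,
      Real.Gamma_add_one (by positivity), ih]
    ring

/-! ### Gauss series and Pfaff's transformation -/

/-- The `n`-th term of the Gauss series `₂F₁(a, b; 1; x)`. -/
noncomputable def gaussTerm (a b x : ℝ) (n : ℕ) : ℝ :=
  (ascPochhammer ℝ n).eval a * (ascPochhammer ℝ n).eval b / (n ! : ℝ) ^ 2 * x ^ n

theorem gaussTerm_succ (a b x : ℝ) (n : ℕ) :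
    gaussTerm a b x (n + 1) = (a + n) * (b + n) / (n + 1) ^ 2 * x * gaussTerm a b x n := by
  simp only [gaussTerm, ascPochhammer_succ_eval, Nat.factorial_succ, pow_succ]
  push_cast
  field_simp

/-- Euler's integral representation of `₂F₁(a, b; 1; x)`. -/
theorem hasSum_gaussTerm (a : ℝ) {b x : ℝ} (hb : 0 < b) (hb1 : b < 1) (hx : |x| < 1) :
    HasSum (gaussTerm a b x) ((Real.Gamma b * Real.Gamma (1 - b))⁻¹ *
      ∫ t in Ioo (0 : ℝ) 1, (1 - x * t) ^ (-a) * (t ^ (b - 1) * (1 - t) ^ (1 - b - 1))) := by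
  have hG : Real.Gamma b ≠ 0 := (Real.Gamma_pos_of_pos hb).ne'
  have hG1 : Real.Gamma (1 - b) ≠ 0 := (Real.Gamma_pos_of_pos (by linarith)).ne'
  have hbound : ∀ᵐ t : ℝ ∂volume.restrict (Ioo 0 1), |t| ≤ 1 :=
    ae_restrict_of_forall_mem measurableSet_Ioo fun t ht => by
      rw [abs_of_pos ht.1]; exact ht.2.le
  have h := (hasSum_integral_one_sub_mul_rpow_neg (g := fun t : ℝ => t)
    aestronglyMeasurable_id hbound
    (Real.integrableOn_rpow_mul_one_sub_rpow hb (sub_pos.2 hb1)).1 a hx).mul_left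
    (Real.Gamma b * Real.Gamma (1 - b))⁻¹
  refine h.of_eq (fun n => ?_) rfl
  have hm : ∫ t in Ioo (0 : ℝ) 1, t ^ n * (t ^ (b - 1) * (1 - t) ^ (1 - b - 1)) =
      (ascPochhammer ℝ n).eval b * Real.Gamma b * Real.Gamma (1 - b) / n ! := by
    rw [← Real.Gamma_add_natCast hb, ← Real.Gamma_nat_eq_factorial,
      show (n : ℝ) + 1 = b + n + (1 - b) by ring,
      ← (Real.integrableOn_rpow_mul_one_sub_rpow (by positivity) (sub_pos.2 hb1)).2]
    refine setIntegral_congr_fun measurableSet_Ioo fun t ht => ?_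
    rw [← mul_assoc, ← Real.rpow_natCast, ← Real.rpow_add ht.1]
    ring_nf
  rw [hm, gaussTerm]
  field_simp

/-- Pfaff's transformation of `₂F₁(a, b; 1; x)`. -/
theorem tsum_gaussTerm_pfaff (a : ℝ) {b x : ℝ} (hb : 0 < b) (hb1 : b < 1) (hx : |x| < 1)
    (hx' : |x / (x - 1)| < 1) :
    ∑' n, gaussTerm a b x n = (1 - x) ^ (-a) * ∑' n, gaussTerm a (1 - b) (x / (x - 1)) n := by
  have h1x : 0 < 1 - x := by linarith [le_abs_self x]
  rw [(hasSum_gaussTerm a hb hb1 hx).tsum_eq,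
    (hasSum_gaussTerm a (sub_pos.2 hb1) (sub_lt_self 1 hb) hx').tsum_eq, sub_sub_cancel,
    mul_left_comm, mul_comm (Real.Gamma b)]
  congr 1
  rw [← integral_const_mul]
  simp_rw [← integral_Ioc_eq_integral_Ioo, ← intervalIntegral.integral_of_le zero_le_one]
  -- The reflection t ↦ 1 - t swaps the exponents b - 1 and -b, and `he` below extracts the factor 1
  -- - x.
  have h := intervalIntegral.integral_comp_sub_left (a := (0 : ℝ)) (b := 1)
    (fun t : ℝ => (1 - x * t) ^ (-a) * (t ^ (b - 1) * (1 - t) ^ (1 - b - 1))) 1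
  rw [sub_self, sub_zero] at h
  rw [← h]
  refine intervalIntegral.integral_congr fun t ht => ?_
  rw [uIcc_of_le zero_le_one] at ht
  have hpos : 0 ≤ 1 - x / (x - 1) * t := by
    have h2 : |x / (x - 1) * t| ≤ 1 := by
      rw [abs_mul, abs_of_nonneg ht.1]
      exact mul_le_one₀ hx'.le ht.1 ht.2
    linarith [le_abs_self (x / (x - 1) * t)]
  have he : 1 - x * (1 - t) = (1 - x) * (1 - x / (x - 1) * t) := by
    have : x - 1 ≠ 0 := by linarith
    field_simp
    ring
  rw [he, Real.mul_rpow h1x.le hpos, sub_sub_cancel]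
  ring

/-! ### The series at a square argument as a trigonometric integral -/

theorem integral_cos_pow_zero_pi (n : ℕ) :
    (∫ t in (0 : ℝ)..Real.pi, Real.cos t ^ (2 * n + 1)) = 0 ∧
    (∫ t in (0 : ℝ)..Real.pi, Real.cos t ^ (2 * n)) =
      Real.pi * (ascPochhammer ℝ n).eval (1 / 2) / n ! := by
  induction n with
  | zero => simp
  | succ n ih =>
    rw [show 2 * (n + 1) + 1 = 2 * n + 1 + 2 by ring, show 2 * (n + 1) = 2 * n + 2 by ring,
      integral_cos_pow, integral_cos_pow, ih.1, ih.2]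
    refine ⟨by simp, ?_⟩
    rw [ascPochhammer_succ_eval, Nat.factorial_succ]
    simp
    field_simp
    ring

theorem ascPochhammer_eval_two_mul (a : ℝ) (n : ℕ) :
    (ascPochhammer ℝ (2 * n)).eval a =
      4 ^ n * (ascPochhammer ℝ n).eval (a / 2) * (ascPochhammer ℝ n).eval ((a + 1) / 2) := by
  induction n with
  | zero => simp
  | succ n ih =>
    rw [show 2 * (n + 1) = 2 * n + 1 + 1 by ring]
    simp only [ascPochhammer_succ_eval, ih, pow_succ]
    push_cast
    ring

theorem factorial_two_mul_eq_ascPochhammer (n : ℕ) :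
    ((2 * n)! : ℝ) = 4 ^ n * (ascPochhammer ℝ n).eval (1 / 2) * n ! := by
  induction n with
  | zero => simp
  | succ n ih =>
    rw [show 2 * (n + 1) = 2 * n + 1 + 1 by ring, Nat.factorial_succ, Nat.factorial_succ,
      Nat.factorial_succ, ascPochhammer_succ_eval]
    push_cast
    rw [ih, pow_succ]
    ring

/-- Odd moments of the cosine vanish, so only powers of x² survive; duplication splits (1/2)_{2n}
into (1/4)_n (3/4)_n. -/
theorem hasSum_gaussTerm_sq {x : ℝ} (hx : |x| < 1) :
    HasSum (gaussTerm (1 / 4) (3 / 4) (x ^ 2))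
      (Real.pi⁻¹ * ∫ t in (0 : ℝ)..Real.pi, (1 - x * Real.cos t) ^ (-(1 / 2) : ℝ)) := by
  have h := (hasSum_integral_one_sub_mul_rpow_neg (μ := volume.restrict (Ioc 0 Real.pi))
    (g := Real.cos) (w := fun _ => 1) Real.continuous_cos.aestronglyMeasurable
    (.of_forall Real.abs_cos_le_one) (integrable_const 1) (1 / 2) hx).mul_left Real.pi⁻¹
  simp only [mul_one, ← intervalIntegral.integral_of_le Real.pi_pos.le] at h
  have hinj : Function.Injective fun n : ℕ => 2 * n := fun m n h => by simpa using h
  rw [← hinj.hasSum_iff] at h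
  · refine h.of_eq (fun n => ?_) rfl
    have h0 : (ascPochhammer ℝ n).eval (1 / 2) ≠ 0 := (ascPochhammer_pos n _ (by norm_num)).ne'
    simp only [Function.comp_apply]
    rw [(integral_cos_pow_zero_pi n).2, factorial_two_mul_eq_ascPochhammer,
      ascPochhammer_eval_two_mul, gaussTerm, pow_mul]
    norm_num
    field_simp
  · intro n hn
    obtain ⟨k, rfl | rfl⟩ := n.even_or_odd'
    · exact absurd ⟨k, rfl⟩ hn
    · rw [(integral_cos_pow_zero_pi k).1, mul_zero, mul_zero]

/-! ### Evaluation at 1/9 and -1/8 -/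

theorem image_sin_half_pow_four :
    (fun θ : ℝ => Real.sin (θ / 2) ^ 4) '' Ioo 0 Real.pi = Ioo 0 1 := by
  refine Subset.antisymm ?_ ?_
  · rintro _ ⟨θ, hθ, rfl⟩
    have hs : 0 < Real.sin (θ / 2) :=
      Real.sin_pos_of_pos_of_lt_pi (by linarith [hθ.1]) (by linarith [hθ.1, hθ.2])
    have hs1 : Real.sin (θ / 2) < 1 := by
      rw [← Real.sin_pi_div_two]
      exact Real.sin_lt_sin_of_lt_of_le_pi_div_two (by linarith [hθ.1, Real.pi_pos]) le_rfl
        (by linarith [hθ.2])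
    exact ⟨by positivity, pow_lt_one₀ hs.le hs1 (by norm_num)⟩
  · have h := intermediate_value_Ioo Real.pi_pos.le
      (f := fun θ : ℝ => Real.sin (θ / 2) ^ 4) (by fun_prop)
    simpa using h

theorem Real.Gamma_one_fourth_mul_Gamma_three_fourths :
    Real.Gamma (1 / 4) * Real.Gamma (3 / 4) = Real.pi * √2 := by
  have h := Real.Gamma_mul_Gamma_one_sub (1 / 4)
  rw [show (1 : ℝ) - 1 / 4 = 3 / 4 by norm_num, mul_one_div, Real.sin_pi_div_four] at h
  rw [h]
  field_simp
  norm_num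

/-- Substitute s = sin⁴(θ/2) in B(1/4, 1/2): the Jacobian cancels all but (1 + sin²(θ/2))^(-1/2),
and 1 + sin²(θ/2) is proportional to 1 - (cos θ)/3. This is what singles out x = 1/3. -/
theorem integral_one_sub_cos_div_three :
    ∫ t in (0 : ℝ)..Real.pi, (1 - 1 / 3 * Real.cos t) ^ (-(1 / 2) : ℝ) =
      √3 * Real.Gamma (1 / 4) ^ 2 / (4 * √Real.pi) := by
  have hB := (Real.integrableOn_rpow_mul_one_sub_rpow (u := 1 / 4) (v := 1 / 2)
    (by norm_num) (by norm_num)).2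
  rw [← image_sin_half_pow_four, integral_image_eq_integral_abs_deriv_smul
    (f' := fun θ => 2 * Real.sin (θ / 2) ^ 3 * Real.cos (θ / 2)) measurableSet_Ioo] at hB
  rotate_left
  · intro θ _
    have h1 := (((hasDerivAt_id θ).div_const 2).sin.pow 4).hasDerivWithinAt (s := Ioo 0 Real.pi)
    refine h1.congr_deriv ?_
    simp
    ring
  · intro x hx y hy hxy
    have hs : ∀ z ∈ Ioo 0 Real.pi, 0 ≤ Real.sin (z / 2) := fun z hz =>
      Real.sin_nonneg_of_nonneg_of_le_pi (by linarith [hz.1]) (by linarith [hz.1, hz.2])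
    have h1 := (pow_left_inj₀ (hs x hx) (hs y hy) (by norm_num)).1 hxy
    have h2 := Real.injOn_sin (x₁ := x / 2) (x₂ := y / 2)
      ⟨by linarith [hx.1, Real.pi_pos], by linarith [hx.2]⟩
      ⟨by linarith [hy.1, Real.pi_pos], by linarith [hy.2]⟩ h1
    linarith
  have hpt : ∀ θ ∈ Ioo 0 Real.pi,
      |2 * Real.sin (θ / 2) ^ 3 * Real.cos (θ / 2)| • ((Real.sin (θ / 2) ^ 4) ^ ((1 / 4 : ℝ) - 1) *
        (1 - Real.sin (θ / 2) ^ 4) ^ ((1 / 2 : ℝ) - 1)) =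
      2 * √2 / √3 * (1 - 1 / 3 * Real.cos θ) ^ (-(1 / 2) : ℝ) := by
    intro θ hθ
    have hs : 0 < Real.sin (θ / 2) :=
      Real.sin_pos_of_pos_of_lt_pi (by linarith [hθ.1]) (by linarith [hθ.1, hθ.2])
    have hc : 0 < Real.cos (θ / 2) :=
      Real.cos_pos_of_mem_Ioo ⟨by linarith [hθ.1, Real.pi_pos], by linarith [hθ.2]⟩
    have hcos : Real.cos θ = 1 - 2 * Real.sin (θ / 2) ^ 2 := by
      rw [← Real.cos_sq_add_sin_sq (θ / 2), show θ = 2 * (θ / 2) by ring, Real.cos_two_mul']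
      ring_nf
    have h1 : (Real.sin (θ / 2) ^ 4) ^ ((1 / 4 : ℝ) - 1) = (Real.sin (θ / 2) ^ 3)⁻¹ := by
      rw [← Real.rpow_natCast, ← Real.rpow_mul hs.le, ← Real.rpow_natCast, ← Real.rpow_neg hs.le]
      norm_num
    have h2 : 1 - Real.sin (θ / 2) ^ 4 = Real.cos (θ / 2) ^ 2 * (1 + Real.sin (θ / 2) ^ 2) := by
      rw [Real.cos_sq']
      ring
    have h3 : 1 - 1 / 3 * Real.cos θ = 2 / 3 * (1 + Real.sin (θ / 2) ^ 2) := by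
      rw [hcos]
      ring
    rw [h1, h2, h3, abs_of_pos (by positivity), smul_eq_mul,
      show (1 / 2 : ℝ) - 1 = -(1 / 2) by norm_num, Real.rpow_neg (by positivity),
      Real.rpow_neg (by positivity), ← Real.sqrt_eq_rpow, ← Real.sqrt_eq_rpow,
      Real.sqrt_mul (by positivity), Real.sqrt_mul (by positivity), Real.sqrt_sq hc.le,
      Real.sqrt_div (by norm_num)]
    field_simp
  rw [setIntegral_congr_fun measurableSet_Ioo hpt, integral_const_mul,
    ← integral_Ioc_eq_integral_Ioo, ← intervalIntegral.integral_of_le Real.pi_pos.le,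
    Real.Gamma_one_half_eq, show (1 / 4 : ℝ) + 1 / 2 = 3 / 4 by norm_num] at hB
  have hG := Real.Gamma_one_fourth_mul_Gamma_three_fourths
  have hG1 : Real.Gamma (1 / 4) ≠ 0 := (Real.Gamma_pos_of_pos (by norm_num)).ne'
  have hπ : √Real.pi ^ 2 = Real.pi := Real.sq_sqrt Real.pi_pos.le
  have hπ0 : √Real.pi ≠ 0 := (Real.sqrt_pos.2 Real.pi_pos).ne'
  have h2 : √(2 : ℝ) ^ 2 = 2 := Real.sq_sqrt (by norm_num)
  have hG3 : Real.Gamma (3 / 4) = √Real.pi ^ 2 * √2 / Real.Gamma (1 / 4) := by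
    rw [hπ, ← hG, mul_div_cancel_left₀ _ hG1]
  rw [hG3] at hB
  field_simp at hB ⊢
  rw [h2] at hB
  linear_combination hB

/-! ### Pairing of terms -/

theorem HasSum.add_two_mul {f : ℕ → ℝ} {S : ℝ} (h : HasSum f S) :
    HasSum (fun n => f (2 * n) + f (2 * n + 1)) S := by
  have he := h.summable.comp_injective (i := fun n : ℕ => 2 * n) fun m n h => by simpa using h
  have ho := h.summable.comp_injective (i := fun n : ℕ => 2 * n + 1) fun m n h => by simpa using h
  have := he.hasSum.add ho.hasSum
  rwa [(he.hasSum.even_add_odd ho.hasSum).unique h] at this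

theorem hasSum_gaussTerm_one_ninth :
    HasSum (gaussTerm (1 / 4) (3 / 4) (1 / 9))
      (√3 * Real.Gamma (1 / 4) ^ 2 / (4 * Real.pi ^ (3 / 2 : ℝ))) := by
  have h := hasSum_gaussTerm_sq (x := 1 / 3) (by norm_num [abs_of_pos])
  rw [integral_one_sub_cos_div_three] at h
  have hπ : Real.pi ^ (3 / 2 : ℝ) = Real.pi * √Real.pi := by
    rw [Real.sqrt_eq_rpow, ← Real.rpow_one_add' Real.pi_pos.le (by norm_num)]
    norm_num
  convert h using 1
  · norm_num
  · rw [hπ]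
    field_simp

theorem hasSum_gaussTerm_neg_one_eighth :
    HasSum (gaussTerm (1 / 4) (1 / 4) (-1 / 8))
      (Real.pi ^ (1 / 2 : ℝ) / ((2 : ℝ) ^ (1 / 4 : ℝ) * Real.Gamma (3 / 4) ^ 2)) := by
  have hx : |(-1 / 8 : ℝ)| < 1 := by norm_num [abs_lt]
  have h := tsum_gaussTerm_pfaff (1 / 4) (b := 1 / 4) (x := -1 / 8) (by norm_num) (by norm_num) hx
    (by norm_num [abs_lt])
  rw [show (1 : ℝ) - 1 / 4 = 3 / 4 by norm_num, show (-1 / 8 : ℝ) / (-1 / 8 - 1) = 1 / 9 by norm_num,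
    hasSum_gaussTerm_one_ninth.tsum_eq] at h
  have hs := (hasSum_gaussTerm (1 / 4) (b := 1 / 4) (by norm_num) (by norm_num) hx).summable.hasSum
  rw [h] at hs
  refine hs.of_eq (fun n => rfl) ?_
  have hG := Real.Gamma_one_fourth_mul_Gamma_three_fourths
  have hG3 : Real.Gamma (3 / 4) ≠ 0 := (Real.Gamma_pos_of_pos (by norm_num)).ne'
  have hG1 : Real.Gamma (1 / 4) = Real.pi * √2 / Real.Gamma (3 / 4) := by
    rw [← hG, mul_div_cancel_right₀ _ hG3]
  have h8 : (1 - -1 / 8 : ℝ) ^ (-(1 / 4) : ℝ) = 2 / (2 ^ (1 / 4 : ℝ) * √3) := by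
    have h9 : (9 : ℝ) ^ (1 / 4 : ℝ) = √3 := by
      rw [show (9 : ℝ) = 3 ^ (2 : ℝ) by norm_num, ← Real.rpow_mul (by norm_num),
        Real.sqrt_eq_rpow]
      norm_num
    have h16 : (8 : ℝ) ^ (1 / 4 : ℝ) * 2 ^ (1 / 4 : ℝ) = 2 := by
      rw [← Real.mul_rpow (by norm_num) (by norm_num),
        show (8 * 2 : ℝ) = 2 ^ (4 : ℝ) by norm_num, ← Real.rpow_mul (by norm_num)]
      norm_num
    rw [show (1 - -1 / 8 : ℝ) = 9 / 8 by norm_num, Real.rpow_neg (by norm_num),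
      Real.div_rpow (by norm_num) (by norm_num), h9, inv_div]
    field_simp
    exact h16
  have hπ : Real.pi ^ (3 / 2 : ℝ) = Real.pi * Real.pi ^ (1 / 2 : ℝ) := by
    rw [← Real.rpow_one_add' Real.pi_pos.le (by norm_num)]
    norm_num
  have hπ2 : (Real.pi ^ (1 / 2 : ℝ)) ^ 2 = Real.pi := by
    rw [← Real.sqrt_eq_rpow, Real.sq_sqrt Real.pi_pos.le]
  have h2 : √(2 : ℝ) ^ 2 = 2 := Real.sq_sqrt (by norm_num)
  rw [h8, hG1, hπ]
  have hπ0 : Real.pi ^ (1 / 2 : ℝ) ≠ 0 := (Real.rpow_pos_of_pos Real.pi_pos _).ne'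
  rw [div_pow, mul_pow, h2]
  generalize Real.pi ^ (1 / 2 : ℝ) = p at hπ2 hπ0
  rw [← hπ2]
  field_simp
  norm_num

theorem factorial_four_mul_eq_ascPochhammer (n : ℕ) :
    ((4 * n)! : ℝ) = 64 ^ n * (ascPochhammer ℝ n).eval (1 / 4) * (ascPochhammer ℝ n).eval (3 / 4) *
      (2 * n)! := by
  rw [show 4 * n = 2 * (2 * n) by ring, factorial_two_mul_eq_ascPochhammer (2 * n),
    ascPochhammer_eval_two_mul, pow_mul, show (64 : ℝ) = 4 ^ 2 * 4 by norm_num, mul_pow]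
  norm_num
  left
  ring

end

theorem mainTheorem12 :
    HasSum
      (fun n : ℕ =>
        ((640 * (n : ℝ) ^ 2 + 608 * (n : ℝ) + 147) * ((8 * n)! : ℝ)) /
          (((2 * n + 1)! : ℝ) ^ 2 * ((4 * n)! : ℝ) * (24 : ℝ) ^ (4 * n)))
      (36 * Real.sqrt 3 * Real.Gamma (1 / 4) ^ 2 / Real.pi ^ (3 / 2 : ℝ)) ∧
    HasSum
      (fun n : ℕ =>
        (448 * (n : ℝ) ^ 2 + 496 * (n : ℝ) + 127) *
          (((ascPochhammer ℝ n).eval (1 / 8) * (ascPochhammer ℝ n).eval (5 / 8)) /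
            ((2 : ℝ) ^ n * ((2 * n + 1)! : ℝ))) ^ 2)
      (128 * Real.pi ^ (1 / 2 : ℝ) /
        ((2 : ℝ) ^ (1 / 4 : ℝ) * Real.Gamma (3 / 4) ^ 2)) := by
  constructor
  -- 144 = 9 · 16 clears denominators: 144(2n+1)² + (8n+1)(8n+3) = 640n² + 608n + 147.
  · refine (hasSum_gaussTerm_one_ninth.add_two_mul.mul_left 144).of_eq (fun n => ?_) ?_
    · rw [gaussTerm_succ, gaussTerm, show 8 * n = 4 * (2 * n) by ring,
        factorial_four_mul_eq_ascPochhammer, show 2 * (2 * n) = 4 * n by ring, Nat.factorial_succ,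
        show 4 * n = 2 * (2 * n) by ring, pow_mul (24 : ℝ),
        show (24 : ℝ) ^ 2 = 64 * 9 by norm_num, mul_pow, one_div_pow]
      push_cast
      field_simp
      ring
    · ring
  -- Likewise 128 = 8 · 16, with 128(2n+1)² - (8n+1)² = 448n² + 496n + 127.
  · refine (hasSum_gaussTerm_neg_one_eighth.add_two_mul.mul_left 128).of_eq (fun n => ?_) ?_
    · have h8 : (-1 / 8 : ℝ) ^ (2 * n) = ((8 : ℝ) ^ n)⁻¹ ^ 2 := by
        rw [inv_pow, ← pow_mul, mul_comm n 2, ← inv_pow, pow_mul, pow_mul]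
        norm_num
      rw [gaussTerm_succ, gaussTerm, ascPochhammer_eval_two_mul, Nat.factorial_succ, h8,
        show (8 : ℝ) = 4 * 2 by norm_num, mul_pow]
      push_cast
      norm_num
      field_simp
      ring
    · ring
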